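/- Consider a bandit with $K$ arms and $L$ objectives and mean matrix $M\in\mathbb R^{L\times K}$, whose $k$-th column $M_k$ is the mean reward vector of arm $k$. In each round $s=1,2,\dots$ a learner, following an arbitrary adaptive (possibly randomised) sampling rule, pulls an arm $k_s$ and observes the reward vector $R_s=M_{k_s}+\eta_s\in\mathbb R^L$, where, conditionally on the past and on $k_s$, each coordinate of the noise is $1$-sub-Gaussian: $\mathbb E[e^{c\,\eta_s^{(\ell)}}\mid \text{past},k_s]\le e^{c^2/2}$ a.s. for all $c\in\mathbb R$ and $\ell\in[L]$. Let $N_a(t)$ be the number of pulls of arm $a$ in the first $t$ rounds and $\hat M_{a,t}$ the empirical mean of the rewards of arm $a$ in these rounds. Let $\mathcal C\subseteq\mathbb R^L$ be a preference cone, i.e. $\mathcal C=\{x: Ax\ge 0\}$ for a real matrix $A$ with linearly independent rows of Euclidean norm $1$, and let $\delta\in(0,1)$. Then, for every $z\in\mathcal C$, with probability at least $1-\delta$, simultaneously for all times $t$ and all pairs of arms $(i,j)\in[K]\times[K]$ with $N_i(t),N_j(t)\ge 1$, $$\left|z^\top(M_i-M_j)-z^\top(\hat M_{i,t}-\hat M_{j,t})\right|\le\beta_{ij}(t),$$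 where $\beta_{ij}(t)\ge 0$ is given by $$\beta_{ij}^2(t)=4\|z\|_1^2\left(h\!\left(\tfrac12\log\tfrac{K_1}{\delta}\right)+\sum_{a\in\{i,j\}}\log\bigl(4+\log N_a(t)\bigr)\right)\left(\sum_{a\in\{i,j\}}\frac1{N_a(t)}\right),$$ with $K_1=\frac{K(K-1)}2$ and $h(x)=x+\log(1+x)$. (For $i=j$ the left-hand side is $0$ and the inequality is trivial, whatever $K_1$ is.) -/

import Mathlib

open MeasureTheory ProbabilityTheory

/-- A preference cone in `ℝ^L`: a polyhedral cone `{x | A x ≥ 0}` whose half-space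
representation `A` has linearly independent rows of Euclidean norm `1` (such a cone is closed,
convex, contains the origin and has non-empty interior). -/
def IsPreferenceCone {L : ℕ} (C : Set (Fin L → ℝ)) : Prop :=
  ∃ (m : ℕ) (A : Matrix (Fin m) (Fin L) ℝ),
    LinearIndependent ℝ A.row ∧ (∀ i, ∑ l, A i l ^ 2 = 1) ∧ C = {x | 0 ≤ A.mulVec x}

/-- `IsBanditInteraction P ℱ M arm R`: a learner interacts with a `K`-armed bandit with
`L` objectives and mean matrix `M` (column `k` is the mean reward vector of arm `k`), using an
arbitrary adaptive, possibly randomised, sampling rule. In round `t = 0, 1, 2, …` it pulls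
`arm t` and observes the reward vector `R t`. The σ-algebra `ℱ t` holds the history before the
reward of round `t` is revealed, including the choice of `arm t`. Given `ℱ t`, each
coordinate of the noise `R t - M_{arm t}` is (centred and) sub-Gaussian with parameter `1`. -/
structure IsBanditInteraction {K L : ℕ} {Ω : Type*} [mΩ : MeasurableSpace Ω]
    (P : Measure Ω) (ℱ : Filtration ℕ mΩ) (M : Matrix (Fin L) (Fin K) ℝ)
    (arm : ℕ → Ω → Fin K) (R : ℕ → Ω → Fin L → ℝ) : Prop where
  measurable_arm : ∀ t, Measurable[ℱ t] (arm t)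
  measurable_reward : ∀ t, Measurable[ℱ (t + 1)] (R t)
  integrable_exp : ∀ (t : ℕ) (l : Fin L) (c : ℝ),
    Integrable (fun ω => Real.exp (c * (R t ω l - M l (arm t ω)))) P
  condExp_exp_le : ∀ (t : ℕ) (l : Fin L) (c : ℝ),
    P[fun ω => Real.exp (c * (R t ω l - M l (arm t ω))) | ℱ t]
      ≤ᵐ[P] fun _ => Real.exp (c ^ 2 / 2)

/-- `N_k(t)`: the number of pulls of arm `k` in the first `t` rounds. -/
def pullCount {K : ℕ} {Ω : Type*} (arm : ℕ → Ω → Fin K) (k : Fin K) (t : ℕ) (ω : Ω) : ℕ :=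
  ((Finset.range t).filter (fun s => arm s ω = k)).card

/-- `M̂_{k,t}`: the empirical mean of the reward vectors observed from arm `k` in the first `t`
rounds (used only when arm `k` has been pulled). -/
noncomputable def empMean {K L : ℕ} {Ω : Type*} (arm : ℕ → Ω → Fin K) (R : ℕ → Ω → Fin L → ℝ)
    (k : Fin K) (t : ℕ) (ω : Ω) : Fin L → ℝ :=
  (pullCount arm k t ω : ℝ)⁻¹ • ∑ s ∈ (Finset.range t).filter (fun s => arm s ω = k), R s ω

/-- The threshold function `h(x) = x + log (1 + x)`. -/
noncomputable def thresholdFn (x : ℝ) : ℝ := x + Real.log (1 + x)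

/-- The number `K₁ = K (K - 1) / 2` of pairs of arms. -/
noncomputable def numPairs (K : ℕ) : ℝ := (K : ℝ) * ((K : ℝ) - 1) / 2

/-- The confidence radius `β_{ij}`, for the preference `z`, confidence `δ` and counts `N`. -/
noncomputable def confRadius {K L : ℕ} (δ : ℝ) (z : Fin L → ℝ) (N : Fin K → ℕ)
    (i j : Fin K) : ℝ :=
  Real.sqrt (4 * (∑ l, |z l|) ^ 2 *
    ((thresholdFn (Real.log (numPairs K / δ) / 2)
        + ∑ a ∈ ({i, j} : Finset (Fin K)), Real.log (4 + Real.log (N a)))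
      * ∑ a ∈ ({i, j} : Finset (Fin K)), 1 / (N a : ℝ)))

/-- The Gaussian integral of the exponential of a quadratic function. -/
theorem lintegral_exp_quadratic_gaussianReal (v : NNReal) (hv : 0 < v) (S N : ℝ) (hN : 0 ≤ N) :
    ∫⁻ θ, ENNReal.ofReal (Real.exp (θ * S - θ ^ 2 * N / 2)) ∂gaussianReal 0 v
      = ENNReal.ofReal ((√(1 + N * v))⁻¹ * Real.exp (S ^ 2 * v / (2 * (1 + N * v)))) := by
  have hv' : (0 : ℝ) < v := hv
  have hD : 0 < 1 + N * v := by positivity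
  set v' : NNReal := ⟨v / (1 + N * v), by positivity⟩ with hv'def
  have hv'c : (v' : ℝ) = v / (1 + N * v) := rfl
  have hv'0 : v' ≠ 0 := by
    intro h
    have : (v' : ℝ) = 0 := by rw [h]; rfl
    rw [hv'c] at this
    have : 0 < (v : ℝ) / (1 + N * v) := by positivity
    linarith
  rw [gaussianReal_of_var_ne_zero _ hv.ne',
    lintegral_withDensity_eq_lintegral_mul _ (measurable_gaussianPDF 0 v) (by fun_prop)]
  have key : ∀ θ : ℝ, (gaussianPDF 0 v * fun θ =>
      ENNReal.ofReal (Real.exp (θ * S - θ ^ 2 * N / 2))) θ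
      = ENNReal.ofReal ((√(1 + N * v))⁻¹ * Real.exp (S ^ 2 * v / (2 * (1 + N * v))))
        * gaussianPDF (S * v') v' θ := by
    intro θ
    simp only [Pi.mul_apply, gaussianPDF, gaussianPDFReal]
    rw [← ENNReal.ofReal_mul (by positivity), ← ENNReal.ofReal_mul (by positivity)]
    congr 1
    have hs : (√(2 * Real.pi * v))⁻¹ = (√(1 + N * v))⁻¹ * (√(2 * Real.pi * v'))⁻¹ := by
      rw [← mul_inv, ← Real.sqrt_mul hD.le, hv'c]
      congr 2
      field_simp
    rw [hs, mul_assoc, ← Real.exp_add, mul_mul_mul_comm, ← Real.exp_add, hv'c]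
    congr 2
    field_simp
    ring
  rw [lintegral_congr key, lintegral_const_mul _ (measurable_gaussianPDF _ _),
    lintegral_gaussianPDF_eq_one _ hv'0, mul_one]

/-- The function `u ↦ (4 + u) ^ (-7/4)`, evaluated at `u = log (n + 1)`. -/
noncomputable def logDecay (n : ℕ) : ℝ := (4 + Real.log (n + 1)) ^ (-(7 / 4) : ℝ)

/-- The unnormalised weights of the scale mixture: they satisfy
`∑ n < N, mixWeight n * √(n + 1) = √N * logDecay (N - 1)`. -/
noncomputable def mixWeight (n : ℕ) : ℝ := logDecay n - √(n / (n + 1)) * logDecay (n - 1)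

theorem logDecay_pos (n : ℕ) : 0 < logDecay n := by
  have : 0 ≤ Real.log ((n : ℝ) + 1) := Real.log_nonneg (by linarith [Nat.cast_nonneg (α := ℝ) n])
  unfold logDecay; positivity

/-- `u ↦ exp (u / 2) * (4 + u) ^ (-7/4)` is monotone on the nonnegative reals. -/
theorem rpow_mul_exp_le (u d : ℝ) (hu : 0 ≤ u) (hd : 0 ≤ d) :
    (4 + u) ^ (-(7 / 4) : ℝ) * Real.exp (-d / 2) ≤ (4 + u + d) ^ (-(7 / 4) : ℝ) := by
  have h1 : 0 < 4 + u := by linarith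
  have h2 : 0 < 4 + u + d := by linarith
  rw [Real.rpow_def_of_pos h1, Real.rpow_def_of_pos h2, ← Real.exp_add, Real.exp_le_exp]
  have h3 : Real.log (4 + u + d) - Real.log (4 + u) ≤ d / 4 := by
    rw [← Real.log_div h2.ne' h1.ne']
    refine (Real.log_le_sub_one_of_pos (by positivity)).trans ?_
    rw [div_sub_one h1.ne', add_sub_cancel_left]
    exact div_le_div_of_nonneg_left hd (by norm_num) (by linarith)
  linarith

theorem rpow_mul_one_sub_exp_le (u d : ℝ) (hu : 0 ≤ u) (hd : 0 ≤ d) :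
    (4 + u) ^ (-(7 / 4) : ℝ) * (1 - Real.exp (-d / 2)) ≤
      2 / 3 * (4 + u) ^ (-(3 / 4) : ℝ) - 2 / 3 * (4 + u + d) ^ (-(3 / 4) : ℝ) := by
  set φ : ℝ → ℝ := fun x => (4 + u) ^ (-(7 / 4) : ℝ) * Real.exp (-x / 2)
    - 2 / 3 * (4 + u + x) ^ (-(3 / 4) : ℝ) with hφ
  have hder : ∀ x : ℝ, 0 ≤ x → HasDerivAt φ ((4 + u) ^ (-(7 / 4) : ℝ) * (Real.exp (-x / 2)
      * (-1 / 2)) - 2 / 3 * (1 * (-(3 / 4)) * (4 + u + x) ^ (-(3 / 4) - 1 : ℝ))) x := by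
    intro x hx
    have h2 : 4 + u + x ≠ 0 := by linarith
    refine HasDerivAt.sub ?_ ?_
    · exact (((hasDerivAt_id x).neg.div_const 2).exp).const_mul _
    · exact (((hasDerivAt_id x).const_add (4 + u)).rpow_const (Or.inl h2)).const_mul _
  have hmono : MonotoneOn φ (Set.Ici 0) := by
    refine monotoneOn_of_hasDerivWithinAt_nonneg (convex_Ici 0)
      (fun x hx => (hder x hx).continuousAt.continuousWithinAt)
      (fun x hx => (hder x (interior_subset hx)).hasDerivWithinAt) ?_
    intro x hx
    have hx : 0 ≤ x := interior_subset hx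
    have h := rpow_mul_exp_le u x hu hx
    have e : (-(3 / 4) - 1 : ℝ) = -(7 / 4) := by norm_num
    rw [e]
    linarith
  have h := hmono (Set.mem_Ici.2 le_rfl) (Set.mem_Ici.2 hd) hd
  simp only [hφ, neg_zero, zero_div, Real.exp_zero, add_zero] at h
  linarith

theorem sqrt_div_eq_exp_log (n : ℕ) : √((n + 1 : ℝ) / (n + 1 + 1))
    = Real.exp (-(Real.log (n + 1 + 1) - Real.log (n + 1)) / 2) := by
  have h1 : (0 : ℝ) < n + 1 := by positivity
  have h2 : (0 : ℝ) < n + 1 + 1 := by positivity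
  rw [Real.sqrt_eq_rpow, Real.rpow_def_of_pos (by positivity), Real.log_div h1.ne' h2.ne']
  congr 1
  ring

theorem log_succ_sub_nonneg (n : ℕ) : 0 ≤ Real.log ((n : ℝ) + 1 + 1) - Real.log (n + 1) :=
  sub_nonneg.2 (Real.log_le_log (by positivity) (by linarith))

theorem log_natCast_add_one_nonneg (n : ℕ) : 0 ≤ Real.log ((n : ℝ) + 1) :=
  Real.log_nonneg (by linarith [Nat.cast_nonneg (α := ℝ) n])

theorem mixWeight_nonneg (n : ℕ) : 0 ≤ mixWeight n := by
  cases n with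
  | zero => simpa [mixWeight] using (logDecay_pos 0).le
  | succ n =>
    have h := rpow_mul_exp_le _ _ (log_natCast_add_one_nonneg n) (log_succ_sub_nonneg n)
    unfold mixWeight logDecay
    push_cast
    rw [sqrt_div_eq_exp_log]
    rw [show 4 + Real.log ((n : ℝ) + 1) + (Real.log (n + 1 + 1) - Real.log (n + 1))
      = 4 + Real.log (n + 1 + 1) by ring] at h
    linarith

theorem sum_mixWeight_mul_sqrt (N : ℕ) :
    ∑ n ∈ Finset.range (N + 1), mixWeight n * √(n + 1) = √(N + 1) * logDecay N := by
  induction N with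
  | zero => simp [mixWeight]
  | succ N ih =>
    rw [Finset.sum_range_succ, ih, mixWeight, Nat.add_sub_cancel]
    push_cast
    have h : √((N + 1 : ℝ) / (N + 1 + 1)) * √(N + 1 + 1) = √(N + 1) := by
      rw [← Real.sqrt_mul (by positivity)]
      congr 1
      field_simp
    linear_combination (-logDecay N) * h

theorem sum_mixWeight_le (N : ℕ) : ∑ n ∈ Finset.range N, mixWeight n ≤ 1 / (3 * √2) := by
  have key : ∀ N : ℕ, ∑ n ∈ Finset.range (N + 1), mixWeight n ≤
      2 / 3 * 4 ^ (-(3 / 4) : ℝ) - 2 / 3 * (4 + Real.log (N + 1)) ^ (-(3 / 4) : ℝ)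
        + logDecay N := by
    intro N
    induction N with
    | zero => simp [mixWeight]
    | succ N ih =>
      rw [Finset.sum_range_succ, mixWeight, Nat.add_sub_cancel]
      have h := rpow_mul_one_sub_exp_le _ _ (log_natCast_add_one_nonneg N) (log_succ_sub_nonneg N)
      rw [show 4 + Real.log ((N : ℝ) + 1) + (Real.log (N + 1 + 1) - Real.log (N + 1))
        = 4 + Real.log (N + 1 + 1) by ring, ← sqrt_div_eq_exp_log] at h
      push_cast
      rw [← logDecay] at h
      linarith
  have h0 : 2 / 3 * (4 : ℝ) ^ (-(3 / 4) : ℝ) = 1 / (3 * √2) := by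
    have h4 : (4 : ℝ) = √2 ^ (4 : ℝ) := by
      rw [show (4 : ℝ) = ((4 : ℕ) : ℝ) by norm_num, Real.rpow_natCast,
        show √2 ^ 4 = (√2 ^ 2) ^ 2 by ring, Real.sq_sqrt (by norm_num)]
      norm_num
    have h5 : ∀ x : ℝ, (4 : ℝ) ^ x = √2 ^ (4 * x) := fun x => by
      rw [Real.rpow_mul (by positivity), ← h4]
    rw [h5, show (4 : ℝ) * (-(3 / 4)) = -(3 : ℕ) by norm_num, Real.rpow_neg (by positivity), Real.rpow_natCast]
    have h2 : √2 ^ 2 = 2 := Real.sq_sqrt (by norm_num)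
    have : √2 ≠ 0 := by positivity
    field_simp
    linarith
  cases N with
  | zero => simp
  | succ N =>
    refine (key N).trans ?_
    rw [h0]
    have hl : 0 < 4 + Real.log ((N : ℝ) + 1) := by linarith [log_natCast_add_one_nonneg N]
    have : logDecay N ≤ 2 / 3 * (4 + Real.log (N + 1)) ^ (-(3 / 4) : ℝ) := by
      rw [logDecay, show (-(7 / 4) : ℝ) = -(3 / 4) - 1 by norm_num, Real.rpow_sub_one hl.ne',
        div_eq_mul_inv, mul_comm]
      refine mul_le_mul_of_nonneg_right ?_ (by positivity)
      rw [inv_le_comm₀ hl (by norm_num)]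
      linarith [log_natCast_add_one_nonneg N]
    linarith

/-- A countable mixture of centred Gaussian distributions with variances proportional to
`1 / (n + 1)`. -/
noncomputable def scaleMixture (ε : ℝ) : Measure ℝ :=
  Measure.sum fun n : ℕ => ENNReal.ofReal (3 * √2 * mixWeight n) •
    gaussianReal 0 (Real.toNNReal ((1 / ε - 1) / (n + 1)))

theorem scaleMixture_univ_le (ε : ℝ) : scaleMixture ε Set.univ ≤ 1 := by
  rw [scaleMixture, Measure.sum_apply _ MeasurableSet.univ]
  refine ENNReal.tsum_le_of_sum_range_le fun N => ?_
  simp only [Measure.smul_apply, measure_univ, smul_eq_mul, mul_one]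
  rw [← ENNReal.ofReal_sum_of_nonneg
    (fun n _ => mul_nonneg (by positivity) (mixWeight_nonneg n)), ← Finset.mul_sum,
    ENNReal.ofReal_le_one]
  calc 3 * √2 * ∑ n ∈ Finset.range N, mixWeight n ≤ 3 * √2 * (1 / (3 * √2)) := by
        gcongr
        exact sum_mixWeight_le N
    _ = 1 := by field_simp

instance isFiniteMeasure_scaleMixture (ε : ℝ) : IsFiniteMeasure (scaleMixture ε) :=
  ⟨(scaleMixture_univ_le ε).trans_lt ENNReal.one_lt_top⟩

theorem le_lintegral_scaleMixture {ε : ℝ} (h0 : 0 < ε) (h1 : ε < 1) (S : ℝ) (N : ℕ) :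
    ENNReal.ofReal (3 * √2 * √ε * Real.exp ((1 - ε) * (S ^ 2 / (2 * (N + 1)))) * logDecay N) ≤
      ∫⁻ θ, ENNReal.ofReal (Real.exp (θ * S - θ ^ 2 * (N + 1) / 2)) ∂scaleMixture ε := by
  set E := Real.exp ((1 - ε) * (S ^ 2 / (2 * (N + 1)))) with hE
  have hN : (0 : ℝ) < N + 1 := by positivity
  have hterm : ∀ n ∈ Finset.range (N + 1),
      ENNReal.ofReal (3 * √2 * √ε * E * (√(N + 1))⁻¹ * (mixWeight n * √(n + 1))) ≤
      ∫⁻ θ, ENNReal.ofReal (Real.exp (θ * S - θ ^ 2 * (N + 1) / 2))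
        ∂(ENNReal.ofReal (3 * √2 * mixWeight n) •
          gaussianReal 0 (Real.toNNReal ((1 / ε - 1) / (n + 1)))) := by
    intro n hn
    have hnN : (n : ℝ) + 1 ≤ N + 1 := by
      have : n ≤ N := Nat.lt_succ_iff.1 (Finset.mem_range.1 hn)
      exact_mod_cast Nat.succ_le_succ this
    have hn0 : (0 : ℝ) < n + 1 := by positivity
    have hw := mixWeight_nonneg n
    have hr : 0 < 1 / ε - 1 := by rw [sub_pos, lt_div_iff₀ h0]; linarith
    have hv : 0 < (1 / ε - 1) / ((n : ℝ) + 1) := by positivity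
    rw [lintegral_smul_measure, lintegral_exp_quadratic_gaussianReal _ (Real.toNNReal_pos.2 hv) S _
      hN.le, Real.coe_toNNReal _ hv.le, smul_eq_mul, ← ENNReal.ofReal_mul (by positivity)]
    set v := (1 / ε - 1) / ((n : ℝ) + 1) with hvdef
    have hD : 0 < 1 + (N + 1) * v := by positivity
    have hvε : v * (ε * (n + 1)) = 1 - ε := by
      rw [hvdef]; field_simp
    have hA : ε * (n + 1) * (1 + (N + 1) * v) ≤ N + 1 := by nlinarith
    have hB : √ε * (√(N + 1))⁻¹ * √(n + 1) ≤ (√(1 + (N + 1) * v))⁻¹ := by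
      rw [← Real.sqrt_inv, ← Real.sqrt_inv, ← Real.sqrt_mul h0.le, ← Real.sqrt_mul (by positivity)]
      refine Real.sqrt_le_sqrt ?_
      rw [le_inv_comm₀ (by positivity) hD, ← one_div, le_div_iff₀ (by positivity)]
      calc (1 + (N + 1) * v) * (ε * ((N : ℝ) + 1)⁻¹ * (n + 1))
          = (ε * (n + 1) * (1 + (N + 1) * v)) / (N + 1) := by ring
        _ ≤ 1 := (div_le_one hN).2 hA
    have hC : E ≤ Real.exp (S ^ 2 * v / (2 * (1 + (N + 1) * v))) := by
      rw [hE, Real.exp_le_exp]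
      have : (1 - ε) / (N + 1) ≤ v / (1 + (N + 1) * v) := by
        rw [div_le_div_iff₀ hN hD]
        have : (1 - ε) * (n + 1) ≤ (N + 1) * (v * (ε * (n + 1))) := by rw [hvε]; nlinarith
        have : 1 - ε ≤ (N + 1) * (v * ε) := by
          refine le_of_mul_le_mul_right ?_ hn0
          linarith
        nlinarith
      calc (1 - ε) * (S ^ 2 / (2 * (N + 1))) = S ^ 2 / 2 * ((1 - ε) / (N + 1)) := by
            field_simp
        _ ≤ S ^ 2 / 2 * (v / (1 + (N + 1) * v)) := by gcongr
        _ = _ := by field_simp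
    refine ENNReal.ofReal_le_ofReal ?_
    calc 3 * √2 * √ε * E * (√(N + 1))⁻¹ * (mixWeight n * √(n + 1))
        = 3 * √2 * mixWeight n * ((√ε * (√(N + 1))⁻¹ * √(n + 1)) * E) := by ring
      _ ≤ _ := by gcongr
  rw [scaleMixture, lintegral_sum_measure]
  refine le_trans ?_ ((Finset.sum_le_sum hterm).trans (ENNReal.sum_le_tsum _))
  rw [← ENNReal.ofReal_sum_of_nonneg (fun n _ => mul_nonneg (by positivity)
    (mul_nonneg (mixWeight_nonneg n) (by positivity))), ← Finset.mul_sum, sum_mixWeight_mul_sqrt]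
  refine ENNReal.ofReal_le_ofReal (le_of_eq ?_)
  have : √((N : ℝ) + 1) ≠ 0 := by positivity
  field_simp

/-- A lower bound for the mixture, in terms of the penalised self-normalised deviation. -/
theorem exp_le_lintegral_scaleMixture {s : ℝ} (hs : 0 ≤ s) (S : ℝ) (N : ℕ) (hN : 1 ≤ N) :
    ENNReal.ofReal (3 / 2 * (√(1 + s))⁻¹ * Real.exp ((1 - 1 / (8 * (1 + s))) *
        (S ^ 2 / (2 * N) - 2 * Real.log (4 + Real.log N)))) ≤
      ∫⁻ θ, ENNReal.ofReal (Real.exp (θ * S - θ ^ 2 * N / 2))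
        ∂scaleMixture (1 / (8 * (1 + s))) := by
  obtain ⟨n, rfl⟩ : ∃ n, N = n + 1 := ⟨N - 1, by omega⟩
  have hε0 : 0 < 1 / (8 * (1 + s)) := by positivity
  have hε1 : 1 / (8 * (1 + s)) ≤ 1 / 8 := by
    refine one_div_le_one_div_of_le (by norm_num) (by linarith)
  push_cast
  refine le_trans (ENNReal.ofReal_le_ofReal ?_)
    (le_lintegral_scaleMixture hε0 (by linarith) S n)
  have hl : 1 ≤ 4 + Real.log ((n : ℝ) + 1) := by linarith [log_natCast_add_one_nonneg n]
  have hc : 3 * √2 * √(1 / (8 * (1 + s))) = 3 / 2 * (√(1 + s))⁻¹ := by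
    rw [mul_assoc, ← Real.sqrt_mul (by norm_num), ← Real.sqrt_inv,
      show 2 * (1 / (8 * (1 + s))) = (1 / 2) ^ 2 * (1 + s)⁻¹ by field_simp; norm_num,
      Real.sqrt_mul (by norm_num), Real.sqrt_sq (by norm_num)]
    ring
  rw [hc, mul_assoc _ (Real.exp _)]
  refine mul_le_mul_of_nonneg_left ?_ (by positivity)
  rw [logDecay, Real.rpow_def_of_pos (by linarith), ← Real.exp_add, Real.exp_le_exp]
  nlinarith [Real.log_nonneg hl]

theorem exp_le_mul_lintegral_scaleMixture {s : ℝ} (hs : 0 ≤ s) (S T : ℝ) (N J : ℕ) (hN : 1 ≤ N)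
    (hJ : 1 ≤ J)
    (h : 2 * (thresholdFn s + (Real.log (4 + Real.log N) + Real.log (4 + Real.log J))) ≤
      S ^ 2 / (2 * N) + T ^ 2 / (2 * J)) :
    ENNReal.ofReal (Real.exp (2 * s)) ≤
      (∫⁻ θ, ENNReal.ofReal (Real.exp (θ * S - θ ^ 2 * N / 2))
        ∂scaleMixture (1 / (8 * (1 + s)))) *
      ∫⁻ θ, ENNReal.ofReal (Real.exp (θ * T - θ ^ 2 * J / 2))
        ∂scaleMixture (1 / (8 * (1 + s))) := by
  refine le_trans ?_ (mul_le_mul' (exp_le_lintegral_scaleMixture hs S N hN)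
    (exp_le_lintegral_scaleMixture hs T J hJ))
  rw [← ENNReal.ofReal_mul (by positivity)]
  refine ENNReal.ofReal_le_ofReal ?_
  rw [mul_mul_mul_comm, ← Real.exp_add, mul_mul_mul_comm, ← mul_inv,
    Real.mul_self_sqrt (by linarith), ← mul_add]
  have h1s : 0 < 1 + s := by linarith
  set ε := 1 / (8 * (1 + s)) with hε
  have hε0 : 0 < ε := by positivity
  have hε1 : ε ≤ 1 / 8 := one_div_le_one_div_of_le (by norm_num) (by linarith)
  have hεs : ε * s ≤ 1 / 8 := by
    rw [hε, div_mul_eq_mul_div, div_le_div_iff₀ (by positivity) (by norm_num)]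
    linarith
  have hlog : 0 ≤ Real.log (1 + s) := Real.log_nonneg (by linarith)
  have hinv : (1 + s)⁻¹ = Real.exp (-Real.log (1 + s)) := by
    rw [Real.exp_neg, Real.exp_log h1s]
  have h94 : Real.exp (1 / 4) ≤ 3 / 2 * (3 / 2) := by
    have h1 := Real.exp_one_lt_d9
    have h2 : Real.exp (1 / 4) ^ 4 = Real.exp 1 := by
      rw [← Real.exp_nat_mul]; norm_num
    by_contra! hcon
    have : (3 / 2 * (3 / 2) : ℝ) ^ 4 < Real.exp (1 / 4) ^ 4 := by gcongr
    norm_num at this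
    linarith
  rw [thresholdFn] at h
  calc Real.exp (2 * s) ≤ Real.exp (1 / 4) * (1 + s)⁻¹ * Real.exp ((1 - ε) *
        (S ^ 2 / (2 * N) - 2 * Real.log (4 + Real.log N) +
          (T ^ 2 / (2 * J) - 2 * Real.log (4 + Real.log J)))) := by
        rw [hinv, ← Real.exp_add, ← Real.exp_add, Real.exp_le_exp]
        have : (1 - ε) * (2 * (s + Real.log (1 + s))) ≤ (1 - ε) *
          (S ^ 2 / (2 * N) - 2 * Real.log (4 + Real.log N) +
          (T ^ 2 / (2 * J) - 2 * Real.log (4 + Real.log J))) :=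
          mul_le_mul_of_nonneg_left (by linarith) (by linarith)
        nlinarith
    _ ≤ _ := by gcongr

/-- Ville's maximal inequality for an `ENNReal`-valued supermartingale. -/
theorem mul_measure_exists_ge_le {Ω : Type*} [mΩ : MeasurableSpace Ω] {P : Measure Ω}
    {ℱ : Filtration ℕ mΩ} {W : ℕ → Ω → ENNReal} (hW : ∀ t, Measurable[ℱ t] (W t))
    (hstep : ∀ t A, MeasurableSet[ℱ t] A → ∫⁻ ω in A, W (t + 1) ω ∂P ≤ ∫⁻ ω in A, W t ω ∂P)
    (c : ENNReal) : c * P {ω | ∃ t, c ≤ W t ω} ≤ ∫⁻ ω, W 0 ω ∂P := by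
  set B : ℕ → Set Ω := fun n => {ω | ∃ t < n, c ≤ W t ω} with hB
  have hset : ∀ t, MeasurableSet[ℱ t] {ω | c ≤ W t ω} := fun t =>
    hW t measurableSet_Ici
  have hBsucc : ∀ n, B (n + 1) = B n ∪ ((B n)ᶜ ∩ {ω | c ≤ W n ω}) := by
    intro n
    ext ω
    simp only [hB, Set.mem_ofPred_eq, Set.mem_union, Set.mem_inter_iff, Set.mem_compl_iff]
    constructor
    · rintro ⟨t, ht, h⟩
      by_cases hω : ∃ t < n, c ≤ W t ω
      · exact Or.inl hω
      · rcases Nat.lt_succ_iff_lt_or_eq.1 ht with ht | rfl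
        · exact absurd ⟨t, ht, h⟩ hω
        · exact Or.inr ⟨hω, h⟩
    · rintro (⟨t, ht, h⟩ | ⟨-, h⟩)
      · exact ⟨t, by omega, h⟩
      · exact ⟨n, by omega, h⟩
  have hBm : ∀ n, MeasurableSet[ℱ n] (B n) := by
    intro n
    induction n with
    | zero => simp [hB]
    | succ n ih =>
      rw [hBsucc]
      exact ℱ.mono n.le_succ _ (ih.union (ih.compl.inter (hset n)))
  have hBm' : ∀ n, MeasurableSet (B n) := fun n => ℱ.le n _ (hBm n)
  have key : ∀ n, c * P (B n) + ∫⁻ ω in (B n)ᶜ, W n ω ∂P ≤ ∫⁻ ω, W 0 ω ∂P := by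
    intro n
    induction n with
    | zero => simp [hB]
    | succ n ih =>
      refine le_trans ?_ ih
      have hs : MeasurableSet {ω | c ≤ W n ω} := ℱ.le n _ (hset n)
      rw [← lintegral_inter_add_sdiff (fun ω => W n ω) ((B n)ᶜ) hs, ← add_assoc]
      refine add_le_add ?_ ?_
      · rw [hBsucc]
        refine (mul_le_mul_right (measure_union_le _ _) c).trans ?_
        rw [mul_add]
        gcongr
        rw [← setLIntegral_const]
        exact setLIntegral_mono' ((hBm' n).compl.inter hs) fun ω hω => hω.2
      · have : (B (n + 1))ᶜ = (B n)ᶜ \ {ω | c ≤ W n ω} := by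
          rw [hBsucc]
          ext ω
          simp only [Set.mem_compl_iff, Set.mem_union, Set.mem_inter_iff, Set.mem_sdiff]
          tauto
        rw [this]
        exact hstep n _ ((hBm n).compl.diff (hset n))
  have hU : {ω | ∃ t, c ≤ W t ω} = ⋃ n, B n := by
    ext ω
    simp only [hB, Set.mem_ofPred_eq, Set.mem_iUnion]
    exact ⟨fun ⟨t, h⟩ => ⟨t + 1, t, t.lt_succ_self, h⟩, fun ⟨_, t, _, h⟩ => ⟨t, h⟩⟩
  have hmono : Monotone B := fun m n hmn ω ⟨t, ht, h⟩ => ⟨t, ht.trans_le hmn, h⟩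
  rw [hU, hmono.measure_iUnion, ENNReal.mul_iSup]
  exact iSup_le fun n => le_self_add.trans (key n)

/-- A bound on `∫ f` over all sets of a sub-σ-algebra extends to measurable multipliers. -/
theorem setLIntegral_mul_le_of_forall {Ω : Type*} {m mΩ : MeasurableSpace Ω} (hm : m ≤ mΩ)
    {P : Measure Ω} {f Y : Ω → ENNReal} (hf : Measurable f) (hY : Measurable[m] Y) {c : ENNReal}
    (h : ∀ A, MeasurableSet[m] A → ∫⁻ ω in A, f ω ∂P ≤ c * P A) {A : Set Ω}
    (hA : MeasurableSet[m] A) : ∫⁻ ω in A, Y ω * f ω ∂P ≤ c * ∫⁻ ω in A, Y ω ∂P := by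
  have hle : (P.withDensity f).trim hm ≤ c • P.trim hm := by
    refine Measure.le_iff.2 fun B hB => ?_
    rw [trim_measurableSet_eq hm hB, withDensity_apply _ (hm _ hB), Measure.smul_apply,
      trim_measurableSet_eq hm hB]
    exact h B hB
  have hAY : Measurable[m] (A.indicator Y) := hY.indicator hA
  calc ∫⁻ ω in A, Y ω * f ω ∂P = ∫⁻ ω, A.indicator Y ω ∂(P.withDensity f) := by
        rw [lintegral_withDensity_eq_lintegral_mul _ hf (hAY.mono hm le_rfl),
          ← lintegral_indicator (hm _ hA)]
        refine lintegral_congr fun ω => ?_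
        by_cases hω : ω ∈ A <;> simp [hω, mul_comm]
    _ = ∫⁻ ω, A.indicator Y ω ∂((P.withDensity f).trim hm) := (lintegral_trim hm hAY).symm
    _ ≤ ∫⁻ ω, A.indicator Y ω ∂(c • P.trim hm) := lintegral_mono' hle le_rfl
    _ = c * ∫⁻ ω in A, Y ω ∂P := by
        rw [lintegral_smul_measure, lintegral_trim hm hAY, lintegral_indicator (hm _ hA),
          smul_eq_mul]

section ArmSum

variable {K : ℕ} {Ω : Type*}

/-- The sum of the noise terms `X s` over the rounds `s < t` in which arm `k` is pulled. -/
noncomputable def armSum (arm : ℕ → Ω → Fin K) (X : ℕ → Ω → ℝ) (k : Fin K) (t : ℕ) (ω : Ω) : ℝ :=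
  ∑ s ∈ (Finset.range t).filter (fun s => arm s ω = k), X s ω

theorem pullCount_eq_armSum (arm : ℕ → Ω → Fin K) (k : Fin K) (t : ℕ) (ω : Ω) :
    (pullCount arm k t ω : ℝ) = armSum arm (fun _ _ => 1) k t ω := by
  simp [pullCount, armSum]

theorem measurable_armSum {mΩ : MeasurableSpace Ω} {ℱ : Filtration ℕ mΩ} {arm : ℕ → Ω → Fin K}
    {X : ℕ → Ω → ℝ} (harm : ∀ t, Measurable[ℱ t] (arm t)) (hX : ∀ t, Measurable[ℱ (t + 1)] (X t))
    (k : Fin K) (t : ℕ) : Measurable[ℱ t] (armSum arm X k t) := by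
  unfold armSum
  simp only [Finset.sum_filter]
  refine Finset.measurable_fun_sum _ fun s hs => ?_
  have hs : s + 1 ≤ t := Finset.mem_range.1 hs
  refine Measurable.ite ?_ ((hX s).mono (ℱ.mono hs) le_rfl) measurable_const
  exact ℱ.mono (s.le_succ.trans hs) _ (harm s (measurableSet_singleton k))

/-- Exponential tilting, with a separate parameter for each arm. -/
noncomputable def expTilt (arm : ℕ → Ω → Fin K) (X : ℕ → Ω → ℝ) (φ : Fin K → ℝ) (t : ℕ) (ω : Ω) :
    ENNReal :=
  ENNReal.ofReal (Real.exp (∑ k, (φ k * armSum arm X k t ω - φ k ^ 2 * pullCount arm k t ω / 2)))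

theorem measurable_expTilt {mΩ : MeasurableSpace Ω} {ℱ : Filtration ℕ mΩ} {arm : ℕ → Ω → Fin K}
    {X : ℕ → Ω → ℝ} (harm : ∀ t, Measurable[ℱ t] (arm t)) (hX : ∀ t, Measurable[ℱ (t + 1)] (X t))
    (φ : Fin K → ℝ) (t : ℕ) : Measurable[ℱ t] (expTilt arm X φ t) := by
  unfold expTilt
  simp only [pullCount_eq_armSum]
  have h1 := fun k => measurable_armSum harm hX k t
  have h2 := fun k => measurable_armSum (ℱ := ℱ) (X := fun _ _ => 1) harm
    (fun _ => measurable_const) k t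
  exact ENNReal.measurable_ofReal.comp (Real.measurable_exp.comp (Finset.measurable_fun_sum _
    fun k _ => ((h1 k).const_mul _).sub (((h2 k).const_mul _).div_const _)))

theorem armSum_succ (arm : ℕ → Ω → Fin K) (X : ℕ → Ω → ℝ) (k : Fin K) (t : ℕ) (ω : Ω) :
    armSum arm X k (t + 1) ω = armSum arm X k t ω + if arm t ω = k then X t ω else 0 := by
  simp only [armSum, Finset.sum_filter, Finset.sum_range_succ]

theorem expTilt_succ (arm : ℕ → Ω → Fin K) (X : ℕ → Ω → ℝ) (φ : Fin K → ℝ) (t : ℕ) (ω : Ω) :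
    expTilt arm X φ (t + 1) ω = ∑ k, ({ω | arm t ω = k}.indicator (expTilt arm X φ t) ω *
      ENNReal.ofReal (Real.exp (φ k * X t ω))) * ENNReal.ofReal (Real.exp (-(φ k ^ 2 / 2))) := by
  rw [Finset.sum_eq_single (arm t ω) (fun k _ hk => by simp [Ne.symm hk]) (by simp)]
  rw [Set.indicator_of_mem (by simp)]
  unfold expTilt
  rw [← ENNReal.ofReal_mul (by positivity), ← ENNReal.ofReal_mul (by positivity), ← Real.exp_add,
    ← Real.exp_add]
  congr 2
  simp only [pullCount_eq_armSum, armSum_succ]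
  have h : ∀ k, φ k * (armSum arm X k t ω + if arm t ω = k then X t ω else 0) -
      φ k ^ 2 * (armSum arm (fun _ _ => 1) k t ω + if arm t ω = k then 1 else 0) / 2
      = (φ k * armSum arm X k t ω - φ k ^ 2 * armSum arm (fun _ _ => 1) k t ω / 2)
        + if arm t ω = k then φ k * X t ω - φ k ^ 2 / 2 else 0 := by
    intro k
    split_ifs <;> ring
  simp only [h, Finset.sum_add_distrib, Finset.sum_ite_eq, Finset.mem_univ, if_true]
  ring

/-- The exponentially tilted process is a supermartingale if the noise is conditionally
`1`-sub-Gaussian. -/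
theorem setLIntegral_expTilt_succ_le {mΩ : MeasurableSpace Ω} {P : Measure Ω} {ℱ : Filtration ℕ mΩ}
    {arm : ℕ → Ω → Fin K} {X : ℕ → Ω → ℝ} (harm : ∀ t, Measurable[ℱ t] (arm t))
    (hX : ∀ t, Measurable[ℱ (t + 1)] (X t))
    (hsub : ∀ t (c : ℝ) A, MeasurableSet[ℱ t] A →
      ∫⁻ ω in A, ENNReal.ofReal (Real.exp (c * X t ω)) ∂P ≤ ENNReal.ofReal (Real.exp (c ^ 2 / 2))
        * P A) (φ : Fin K → ℝ) (t : ℕ) (A : Set Ω) (hA : MeasurableSet[ℱ t] A) :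
    ∫⁻ ω in A, expTilt arm X φ (t + 1) ω ∂P ≤ ∫⁻ ω in A, expTilt arm X φ t ω ∂P := by
  have hset : ∀ k, MeasurableSet[ℱ t] {ω | arm t ω = k} := fun k =>
    harm t (measurableSet_singleton k)
  have hY : ∀ k, Measurable[ℱ t] ({ω | arm t ω = k}.indicator (expTilt arm X φ t)) := fun k =>
    (measurable_expTilt harm hX φ t).indicator (hset k)
  have hY' := fun k => (hY k).mono (ℱ.le t) le_rfl
  have hX' : Measurable (X t) := (hX t).mono (ℱ.le _) le_rfl
  have hf : ∀ k, Measurable fun ω => ENNReal.ofReal (Real.exp (φ k * X t ω)) := fun k => by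
    fun_prop
  simp only [expTilt_succ]
  have hYf : ∀ k, Measurable fun ω => {ω | arm t ω = k}.indicator (expTilt arm X φ t) ω *
      ENNReal.ofReal (Real.exp (φ k * X t ω)) := fun k => (hY' k).mul (hf k)
  rw [lintegral_finsetSum _ fun k _ => (hYf k).mul_const _]
  calc _ ≤ ∑ k, ∫⁻ ω in A, {ω | arm t ω = k}.indicator (expTilt arm X φ t) ω ∂P := by
        refine Finset.sum_le_sum fun k _ => ?_
        rw [lintegral_mul_const _ (hYf k)]
        refine (mul_le_mul_left (setLIntegral_mul_le_of_forall (ℱ.le t) (hf k) (hY k)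
          (hsub t (φ k)) hA) _).trans (le_of_eq ?_)
        rw [mul_right_comm, ← ENNReal.ofReal_mul (by positivity), ← Real.exp_add, add_neg_cancel,
          Real.exp_zero, ENNReal.ofReal_one, one_mul]
    _ = ∫⁻ ω in A, expTilt arm X φ t ω ∂P := by
        rw [← lintegral_finsetSum _ fun k _ => hY' k]
        refine lintegral_congr fun ω => ?_
        rw [Finset.sum_eq_single (arm t ω) (fun k _ hk => by simp [Ne.symm hk]) (by simp)]
        simp

/-- The mixture over the tilting parameter, for one arm. -/
noncomputable def mixTilt (π : Measure ℝ) (arm : ℕ → Ω → Fin K) (X : ℕ → Ω → ℝ) (k : Fin K) (t : ℕ)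
    (ω : Ω) : ENNReal :=
  ∫⁻ θ, ENNReal.ofReal (Real.exp (θ * armSum arm X k t ω - θ ^ 2 * pullCount arm k t ω / 2)) ∂π

theorem measurable_mixTilt {mΩ : MeasurableSpace Ω} {ℱ : Filtration ℕ mΩ} {arm : ℕ → Ω → Fin K}
    {X : ℕ → Ω → ℝ} (harm : ∀ t, Measurable[ℱ t] (arm t)) (hX : ∀ t, Measurable[ℱ (t + 1)] (X t))
    (π : Measure ℝ) [IsFiniteMeasure π] (k : Fin K) (t : ℕ) :
    Measurable[ℱ t] (mixTilt π arm X k t) := by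
  have h1 := measurable_armSum harm hX k t
  have h2 := measurable_armSum (ℱ := ℱ) (X := fun _ _ => 1) harm (fun _ => measurable_const) k t
  unfold mixTilt
  simp only [pullCount_eq_armSum]
  generalize ℱ t = m at h1 h2 ⊢
  refine Measurable.lintegral_prod_right' (f := fun p : Ω × ℝ => ENNReal.ofReal (Real.exp
    (p.2 * armSum arm X k t p.1 - p.2 ^ 2 * armSum arm (fun _ _ => 1) k t p.1 / 2))) ?_
  fun_prop

theorem expTilt_pair (arm : ℕ → Ω → Fin K) (X : ℕ → Ω → ℝ) {i j : Fin K} (hij : i ≠ j) (a b : ℝ)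
    (t : ℕ) (ω : Ω) : expTilt arm X (Function.update (Function.update 0 j b) i a) t ω
      = ENNReal.ofReal (Real.exp (a * armSum arm X i t ω - a ^ 2 * pullCount arm i t ω / 2)) *
        ENNReal.ofReal (Real.exp (b * armSum arm X j t ω - b ^ 2 * pullCount arm j t ω / 2)) := by
  unfold expTilt
  rw [← ENNReal.ofReal_mul (by positivity), ← Real.exp_add, ← Finset.sum_subset
    (Finset.subset_univ {i, j}), Finset.sum_pair hij]
  · simp [Function.update_of_ne hij.symm]
  · intro k _ hk
    simp only [Finset.mem_insert, Finset.mem_singleton, not_or] at hk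
    simp [Function.update_of_ne hk.1, Function.update_of_ne hk.2]

theorem measure_exists_mixTilt_mul_ge_le {mΩ : MeasurableSpace Ω} {P : Measure Ω}
    [IsProbabilityMeasure P] {ℱ : Filtration ℕ mΩ}
    {arm : ℕ → Ω → Fin K} {X : ℕ → Ω → ℝ} (harm : ∀ t, Measurable[ℱ t] (arm t))
    (hX : ∀ t, Measurable[ℱ (t + 1)] (X t))
    (hsub : ∀ t (c : ℝ) A, MeasurableSet[ℱ t] A →
      ∫⁻ ω in A, ENNReal.ofReal (Real.exp (c * X t ω)) ∂P ≤ ENNReal.ofReal (Real.exp (c ^ 2 / 2))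
        * P A) {i j : Fin K} (hij : i ≠ j) (π : Measure ℝ) [IsFiniteMeasure π]
    (hπ : π Set.univ ≤ 1) (c : ENNReal) :
    c * P {ω | ∃ t, c ≤ mixTilt π arm X i t ω * mixTilt π arm X j t ω} ≤ 1 := by
  set G : ℕ → Ω → ℝ × ℝ → ENNReal := fun t ω p =>
    expTilt arm X (Function.update (Function.update 0 j p.2) i p.1) t ω with hG
  have hprod : ∀ t ω, mixTilt π arm X i t ω * mixTilt π arm X j t ω = ∫⁻ p, G t ω p ∂(π.prod π) := by
    intro t ω
    simp only [hG, expTilt_pair _ _ hij, mixTilt]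
    exact (lintegral_prod_mul
      (f := fun θ : ℝ => ENNReal.ofReal (Real.exp (θ * armSum arm X i t ω -
        θ ^ 2 * pullCount arm i t ω / 2)))
      (g := fun θ : ℝ => ENNReal.ofReal (Real.exp (θ * armSum arm X j t ω -
        θ ^ 2 * pullCount arm j t ω / 2))) (by fun_prop) (by fun_prop)).symm
  have hGm : ∀ t, Measurable (Function.uncurry (G t)) := by
    intro t
    have h1 := fun k => (measurable_armSum harm hX k t).mono (ℱ.le t) le_rfl
    have h2 := fun k => (measurable_armSum (ℱ := ℱ) (X := fun _ _ => 1) harm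
      (fun _ => measurable_const) k t).mono (ℱ.le t) le_rfl
    simp only [hG, expTilt_pair _ _ hij, pullCount_eq_armSum]
    unfold Function.uncurry
    fun_prop
  refine (mul_measure_exists_ge_le (W := fun t ω => mixTilt π arm X i t ω * mixTilt π arm X j t ω)
    (ℱ := ℱ) (P := P)
    (fun t => (measurable_mixTilt harm hX π i t).mul (measurable_mixTilt harm hX π j t)) ?_
    c).trans ?_
  · intro t A hA
    simp only [hprod]
    rw [lintegral_lintegral_swap (hGm _).aemeasurable, lintegral_lintegral_swap (hGm _).aemeasurable]
    exact lintegral_mono fun p => setLIntegral_expTilt_succ_le harm hX hsub _ t A hA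
  · have h0 : ∀ k ω, mixTilt π arm X k 0 ω = π Set.univ := by
      intro k ω
      simp [mixTilt, armSum, pullCount]
    simp only [h0, lintegral_const, measure_univ, mul_one]
    exact mul_le_one' hπ hπ

theorem measure_exists_deviation_le {mΩ : MeasurableSpace Ω} {P : Measure Ω}
    [IsProbabilityMeasure P] {ℱ : Filtration ℕ mΩ}
    {arm : ℕ → Ω → Fin K} {X : ℕ → Ω → ℝ} (harm : ∀ t, Measurable[ℱ t] (arm t))
    (hX : ∀ t, Measurable[ℱ (t + 1)] (X t))
    (hsub : ∀ t (c : ℝ) A, MeasurableSet[ℱ t] A →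
      ∫⁻ ω in A, ENNReal.ofReal (Real.exp (c * X t ω)) ∂P ≤ ENNReal.ofReal (Real.exp (c ^ 2 / 2))
        * P A) {i j : Fin K} (hij : i ≠ j) {s : ℝ} (hs : 0 ≤ s) :
    P {ω | ∃ t, 1 ≤ pullCount arm i t ω ∧ 1 ≤ pullCount arm j t ω ∧
      2 * (thresholdFn s + (Real.log (4 + Real.log (pullCount arm i t ω)) +
        Real.log (4 + Real.log (pullCount arm j t ω)))) ≤
      armSum arm X i t ω ^ 2 / (2 * pullCount arm i t ω) +
        armSum arm X j t ω ^ 2 / (2 * pullCount arm j t ω)} ≤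
    ENNReal.ofReal (Real.exp (-(2 * s))) := by
  have h := measure_exists_mixTilt_mul_ge_le harm hX hsub hij (scaleMixture (1 / (8 * (1 + s))))
    (scaleMixture_univ_le _) (ENNReal.ofReal (Real.exp (2 * s)))
  rw [Real.exp_neg, ENNReal.ofReal_inv_of_pos (Real.exp_pos _), ENNReal.le_inv_iff_mul_le, mul_comm]
  refine le_trans (mul_le_mul_right (measure_mono ?_) _) h
  rintro ω ⟨t, hi, hj, hd⟩
  exact ⟨t, exp_le_mul_lintegral_scaleMixture hs _ _ _ _ hi hj hd⟩

end ArmSum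

theorem IsBanditInteraction.setLIntegral_exp_le {K L : ℕ} {Ω : Type*} [mΩ : MeasurableSpace Ω]
    {P : Measure Ω} [IsProbabilityMeasure P] {ℱ : Filtration ℕ mΩ} {M : Matrix (Fin L) (Fin K) ℝ}
    {arm : ℕ → Ω → Fin K} {R : ℕ → Ω → Fin L → ℝ} (hR : IsBanditInteraction P ℱ M arm R)
    (t : ℕ) (l : Fin L) (c : ℝ) {A : Set Ω} (hA : MeasurableSet[ℱ t] A) :
    ∫⁻ ω in A, ENNReal.ofReal (Real.exp (c * (R t ω l - M l (arm t ω)))) ∂P ≤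
      ENNReal.ofReal (Real.exp (c ^ 2 / 2)) * P A := by
  have hint := hR.integrable_exp t l c
  rw [← ofReal_integral_eq_lintegral_ofReal hint.restrict (ae_of_all _ fun _ => (Real.exp_pos _).le),
    ← setIntegral_condExp (ℱ.le t) hint hA, ← ofReal_measureReal (μ := P) (s := A),
    ← ENNReal.ofReal_mul (Real.exp_pos _).le]
  refine ENNReal.ofReal_le_ofReal ?_
  calc _ ≤ ∫ _ in A, Real.exp (c ^ 2 / 2) ∂P :=
        setIntegral_mono_ae integrable_condExp.integrableOn (integrable_const _).integrableOn
          (hR.condExp_exp_le t l c)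
    _ = _ := by rw [setIntegral_const, smul_eq_mul, mul_comm]

/-- The noise in round `t`, projected on `z` and normalised by `‖z‖₁`. -/
noncomputable def projNoise {K L : ℕ} {Ω : Type*} (M : Matrix (Fin L) (Fin K) ℝ)
    (arm : ℕ → Ω → Fin K) (R : ℕ → Ω → Fin L → ℝ) (z : Fin L → ℝ) (t : ℕ) (ω : Ω) : ℝ :=
  (∑ l, z l * (R t ω l - M l (arm t ω))) / ∑ l, |z l|

theorem exp_mul_sum_div_le {L : ℕ} {z : Fin L → ℝ} (hz : 0 < ∑ l, |z l|) (c : ℝ) (y : Fin L → ℝ) :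
    Real.exp (c * ((∑ l, z l * y l) / ∑ l, |z l|)) ≤
      ∑ l, |z l| / (∑ l, |z l|) * Real.exp ((if 0 ≤ z l then c else -c) * y l) := by
  have h := convexOn_exp.map_sum_le (t := Finset.univ) (w := fun l => |z l| / ∑ l, |z l|)
    (p := fun l => (if 0 ≤ z l then c else -c) * y l) (fun l _ => by positivity)
    (by rw [← Finset.sum_div, div_self hz.ne']) (fun _ _ => Set.mem_univ _)
  simp only [smul_eq_mul] at h
  refine le_trans (le_of_eq ?_) h
  congr 1
  rw [mul_div_assoc', Finset.mul_sum, Finset.sum_div]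
  refine Finset.sum_congr rfl fun l _ => ?_
  split_ifs with hl
  · rw [abs_of_nonneg hl]; ring
  · rw [abs_of_neg (not_le.1 hl)]; ring

theorem IsBanditInteraction.measurable_coord_sub {K L : ℕ} {Ω : Type*} [mΩ : MeasurableSpace Ω]
    {P : Measure Ω} {ℱ : Filtration ℕ mΩ} {M : Matrix (Fin L) (Fin K) ℝ}
    {arm : ℕ → Ω → Fin K} {R : ℕ → Ω → Fin L → ℝ} (hR : IsBanditInteraction P ℱ M arm R)
    (t : ℕ) (l : Fin L) : Measurable[ℱ (t + 1)] fun ω => R t ω l - M l (arm t ω) :=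
  ((measurable_pi_apply l).comp (hR.measurable_reward t)).sub
    ((measurable_of_finite fun k => M l k).comp
      ((hR.measurable_arm t).mono (ℱ.mono t.le_succ) le_rfl))

theorem IsBanditInteraction.measurable_projNoise {K L : ℕ} {Ω : Type*} [mΩ : MeasurableSpace Ω]
    {P : Measure Ω} {ℱ : Filtration ℕ mΩ} {M : Matrix (Fin L) (Fin K) ℝ}
    {arm : ℕ → Ω → Fin K} {R : ℕ → Ω → Fin L → ℝ} (hR : IsBanditInteraction P ℱ M arm R)
    (z : Fin L → ℝ) (t : ℕ) : Measurable[ℱ (t + 1)] (projNoise M arm R z t) :=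
  (Finset.measurable_fun_sum _ fun l _ => (hR.measurable_coord_sub t l).const_mul _).div_const _

theorem IsBanditInteraction.setLIntegral_exp_projNoise_le {K L : ℕ} {Ω : Type*}
    [mΩ : MeasurableSpace Ω]
    {P : Measure Ω} [IsProbabilityMeasure P] {ℱ : Filtration ℕ mΩ} {M : Matrix (Fin L) (Fin K) ℝ}
    {arm : ℕ → Ω → Fin K} {R : ℕ → Ω → Fin L → ℝ} (hR : IsBanditInteraction P ℱ M arm R)
    {z : Fin L → ℝ} (hz : 0 < ∑ l, |z l|) (t : ℕ) (c : ℝ) (A : Set Ω) (hA : MeasurableSet[ℱ t] A) :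
    ∫⁻ ω in A, ENNReal.ofReal (Real.exp (c * projNoise M arm R z t ω)) ∂P ≤
      ENNReal.ofReal (Real.exp (c ^ 2 / 2)) * P A := by
  have hm : ∀ l, Measurable fun ω => R t ω l - M l (arm t ω) := fun l =>
    (hR.measurable_coord_sub t l).mono (ℱ.le _) le_rfl
  calc ∫⁻ ω in A, ENNReal.ofReal (Real.exp (c * projNoise M arm R z t ω)) ∂P
      ≤ ∫⁻ ω in A, ∑ l, ENNReal.ofReal (|z l| / (∑ l, |z l|)) * ENNReal.ofReal
          (Real.exp ((if 0 ≤ z l then c else -c) * (R t ω l - M l (arm t ω)))) ∂P := by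
        refine lintegral_mono fun ω => ?_
        refine (ENNReal.ofReal_le_ofReal (exp_mul_sum_div_le hz c _)).trans (le_of_eq ?_)
        rw [ENNReal.ofReal_sum_of_nonneg fun l _ => by positivity]
        exact Finset.sum_congr rfl fun l _ => ENNReal.ofReal_mul (by positivity)
    _ = ∑ l, ENNReal.ofReal (|z l| / (∑ l, |z l|)) * ∫⁻ ω in A, ENNReal.ofReal
          (Real.exp ((if 0 ≤ z l then c else -c) * (R t ω l - M l (arm t ω)))) ∂P := by
        rw [lintegral_finsetSum _ fun l _ => by have := hm l; fun_prop]
        exact Finset.sum_congr rfl fun l _ => lintegral_const_mul _ (by have := hm l; fun_prop)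
    _ ≤ ∑ l, ENNReal.ofReal (|z l| / (∑ l, |z l|)) *
          (ENNReal.ofReal (Real.exp (c ^ 2 / 2)) * P A) := by
        refine Finset.sum_le_sum fun l _ => mul_le_mul_right ?_ _
        have h := hR.setLIntegral_exp_le t l (if 0 ≤ z l then c else -c) hA
        rwa [show (if 0 ≤ z l then c else -c) ^ 2 = c ^ 2 by split_ifs <;> ring] at h
    _ = ENNReal.ofReal (Real.exp (c ^ 2 / 2)) * P A := by
        rw [← Finset.sum_mul, ← ENNReal.ofReal_sum_of_nonneg fun l _ => by positivity,
          ← Finset.sum_div, div_self hz.ne', ENNReal.ofReal_one, one_mul]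

theorem dotProduct_empMean_sub {K L : ℕ} {Ω : Type*} (M : Matrix (Fin L) (Fin K) ℝ)
    (arm : ℕ → Ω → Fin K) (R : ℕ → Ω → Fin L → ℝ) {z : Fin L → ℝ} (hz : 0 < ∑ l, |z l|) {k : Fin K}
    {t : ℕ} {ω : Ω} (hk : 1 ≤ pullCount arm k t ω) :
    z ⬝ᵥ empMean arm R k t ω - z ⬝ᵥ M.col k = (∑ l, |z l|) *
      (armSum arm (projNoise M arm R z) k t ω / pullCount arm k t ω) := by
  have hN : (pullCount arm k t ω : ℝ) ≠ 0 := by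
    have : 0 < pullCount arm k t ω := hk
    positivity
  have h1 : (∑ l, |z l|) * armSum arm (projNoise M arm R z) k t ω =
      z ⬝ᵥ (∑ s ∈ (Finset.range t).filter (fun s => arm s ω = k), R s ω)
        - pullCount arm k t ω * (z ⬝ᵥ M.col k) := by
    rw [armSum, Finset.mul_sum, dotProduct_sum, pullCount, ← nsmul_eq_mul, ← Finset.sum_const,
      ← Finset.sum_sub_distrib]
    refine Finset.sum_congr rfl fun s hs => ?_
    rw [projNoise, mul_div_cancel₀ _ hz.ne', (Finset.mem_filter.1 hs).2, dotProduct, dotProduct,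
      ← Finset.sum_sub_distrib]
    exact Finset.sum_congr rfl fun l _ => by rw [mul_sub]; rfl
  rw [empMean, dotProduct_smul, smul_eq_mul, ← mul_div_assoc, h1]
  field_simp

/-- A weighted Cauchy-Schwarz inequality. -/
theorem sub_div_sq_le {S T N J : ℝ} (hN : 0 < N) (hJ : 0 < J) :
    (S / N - T / J) ^ 2 ≤ 2 * (S ^ 2 / (2 * N) + T ^ 2 / (2 * J)) * (1 / N + 1 / J) := by
  have : 2 * (S ^ 2 / (2 * N) + T ^ 2 / (2 * J)) * (1 / N + 1 / J) - (S / N - T / J) ^ 2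
      = (S + T) ^ 2 / (N * J) := by
    field_simp
    ring
  have h : 0 ≤ (S + T) ^ 2 / (N * J) := by positivity
  linarith

theorem card_filter_lt (K : ℕ) : ((Finset.univ.filter fun p : Fin K × Fin K => p.1 < p.2).card : ℝ)
    = numPairs K := by
  have h1 : (Finset.univ.filter fun p : Fin K × Fin K => p.1 < p.2).card
      = (Finset.univ.filter fun p : Fin K × Fin K => p.2 < p.1).card :=
    Finset.card_equiv (Equiv.prodComm _ _) (by simp)
  have h2 : (Finset.univ : Finset (Fin K)).offDiag =
      (Finset.univ.filter fun p : Fin K × Fin K => p.1 < p.2) ∪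
        Finset.univ.filter fun p : Fin K × Fin K => p.2 < p.1 := by
    ext p
    simp [lt_or_lt_iff_ne]
  have h3 := Finset.offDiag_card (Finset.univ : Finset (Fin K))
  rw [h2, Finset.card_union_of_disjoint, ← h1, Finset.card_univ, Fintype.card_fin] at h3
  · have h4 : K ≤ K * K := Nat.le_mul_self K
    have h5 : (((Finset.univ.filter fun p : Fin K × Fin K => p.1 < p.2).card : ℝ) +
      (Finset.univ.filter fun p : Fin K × Fin K => p.1 < p.2).card) = K * K - K := by
      rw [← Nat.cast_add, h3, Nat.cast_sub h4, Nat.cast_mul]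
    rw [numPairs]
    linarith
  · rw [Finset.disjoint_filter]
    exact fun p _ h h' => lt_asymm h h'

theorem confRadius_comm {K L : ℕ} (δ : ℝ) (z : Fin L → ℝ) (N : Fin K → ℕ) (i j : Fin K) :
    confRadius δ z N i j = confRadius δ z N j i := by
  unfold confRadius
  rw [Finset.pair_comm]

theorem theorem6 {K L : ℕ} {Ω : Type*} [mΩ : MeasurableSpace Ω]
    (P : Measure Ω) [IsProbabilityMeasure P] (ℱ : Filtration ℕ mΩ)
    (M : Matrix (Fin L) (Fin K) ℝ) (arm : ℕ → Ω → Fin K) (R : ℕ → Ω → Fin L → ℝ)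
    (hR : IsBanditInteraction P ℱ M arm R)
    (C : Set (Fin L → ℝ)) (hC : IsPreferenceCone C) (z : Fin L → ℝ) (hz : z ∈ C)
    (δ : ℝ) (hδ0 : 0 < δ) (hδ1 : δ < 1) :
    1 - δ ≤ P.real {ω | ∀ (t : ℕ) (i j : Fin K),
      1 ≤ pullCount arm i t ω → 1 ≤ pullCount arm j t ω →
      |z ⬝ᵥ (M.col i - M.col j) - z ⬝ᵥ (empMean arm R i t ω - empMean arm R j t ω)|
        ≤ confRadius δ z (fun a => pullCount arm a t ω) i j} := by
  set good := {ω | ∀ (t : ℕ) (i j : Fin K),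
      1 ≤ pullCount arm i t ω → 1 ≤ pullCount arm j t ω →
      |z ⬝ᵥ (M.col i - M.col j) - z ⬝ᵥ (empMean arm R i t ω - empMean arm R j t ω)|
        ≤ confRadius δ z (fun a => pullCount arm a t ω) i j} with hgood
  rcases (Finset.sum_nonneg fun l (_ : l ∈ Finset.univ) => abs_nonneg (z l)).eq_or_lt with h0 | hz1
  · have hz0 : z = 0 := by
      funext l
      exact abs_eq_zero.1 ((Finset.sum_eq_zero_iff_of_nonneg fun l _ => abs_nonneg (z l)).1 h0.symm l
        (Finset.mem_univ l))
    have : good = Set.univ := by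
      refine Set.eq_univ_of_forall fun ω t i j _ _ => ?_
      simp only [hz0, zero_dotProduct, sub_zero, abs_zero]
      exact Real.sqrt_nonneg _
    rw [this, probReal_univ]
    linarith
  set s := Real.log (numPairs K / δ) / 2 with hs
  set X := projNoise M arm R z with hX
  set bad : Fin K × Fin K → Set Ω := fun p => {ω | ∃ t, 1 ≤ pullCount arm p.1 t ω ∧
    1 ≤ pullCount arm p.2 t ω ∧
      2 * (thresholdFn s + (Real.log (4 + Real.log (pullCount arm p.1 t ω)) +
        Real.log (4 + Real.log (pullCount arm p.2 t ω)))) ≤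
      armSum arm X p.1 t ω ^ 2 / (2 * pullCount arm p.1 t ω) +
        armSum arm X p.2 t ω ^ 2 / (2 * pullCount arm p.2 t ω)} with hbad
  set pairs := Finset.univ.filter fun p : Fin K × Fin K => p.1 < p.2 with hpairs
  have hcard : (pairs.card : ℝ) = numPairs K := card_filter_lt K
  have hle : ∀ ω ∉ ⋃ p ∈ pairs, bad p, ∀ t i j, i < j →
      1 ≤ pullCount arm i t ω → 1 ≤ pullCount arm j t ω →
      |z ⬝ᵥ (M.col i - M.col j) - z ⬝ᵥ (empMean arm R i t ω - empMean arm R j t ω)|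
        ≤ confRadius δ z (fun a => pullCount arm a t ω) i j := by
    intro ω hω t i j hij hi hj
    have hnb : ω ∉ bad (i, j) := fun h =>
      hω (Set.mem_iUnion₂.2 ⟨(i, j), Finset.mem_filter.2 ⟨Finset.mem_univ _, hij⟩, h⟩)
    have hdev : armSum arm X i t ω ^ 2 / (2 * pullCount arm i t ω) +
        armSum arm X j t ω ^ 2 / (2 * pullCount arm j t ω) <
        2 * (thresholdFn s + (Real.log (4 + Real.log (pullCount arm i t ω)) +
        Real.log (4 + Real.log (pullCount arm j t ω)))) := by
      by_contra! hcon
      exact hnb ⟨t, hi, hj, hcon⟩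
    have hi0 : (0 : ℝ) < pullCount arm i t ω := by exact_mod_cast hi
    have hj0 : (0 : ℝ) < pullCount arm j t ω := by exact_mod_cast hj
    rw [confRadius, Finset.sum_pair hij.ne, Finset.sum_pair hij.ne]
    refine Real.abs_le_sqrt ?_
    have e1 := dotProduct_empMean_sub M arm R hz1 hi
    have e2 := dotProduct_empMean_sub M arm R hz1 hj
    have e : z ⬝ᵥ (M.col i - M.col j) - z ⬝ᵥ (empMean arm R i t ω - empMean arm R j t ω)
        = -((∑ l, |z l|) * (armSum arm X i t ω / pullCount arm i t ω
          - armSum arm X j t ω / pullCount arm j t ω)) := by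
      rw [dotProduct_sub, dotProduct_sub]
      linear_combination e2 - e1
    rw [e, neg_sq, mul_pow, mul_comm 4, mul_assoc (_ ^ 2)]
    refine mul_le_mul_of_nonneg_left ?_ (by positivity)
    refine (sub_div_sq_le hi0 hj0).trans ?_
    rw [← mul_assoc]
    refine mul_le_mul_of_nonneg_right ?_ (by positivity)
    linarith
  have hsub : goodᶜ ⊆ ⋃ p ∈ pairs, bad p := by
    intro ω hω
    by_contra hnot
    refine hω fun t i j hi hj => ?_
    rcases lt_trichotomy i j with hij | rfl | hij
    · exact hle ω hnot t i j hij hi hj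
    · simp only [sub_self, dotProduct_zero, abs_zero]
      exact Real.sqrt_nonneg _
    · rw [confRadius_comm, ← abs_neg, neg_sub']
      simp only [← dotProduct_neg, neg_sub]
      exact hle ω hnot t j i hij hj hi
  have hpair : ∀ p ∈ pairs, P (bad p) ≤ ENNReal.ofReal (δ / numPairs K) := by
    intro p hp
    have h1 : 1 ≤ numPairs K := by
      rw [← hcard]
      exact_mod_cast Finset.card_pos.2 ⟨p, hp⟩
    have h2 : 1 ≤ numPairs K / δ := by
      rw [le_div_iff₀ hδ0]
      linarith
    have hs0 : 0 ≤ s := div_nonneg (Real.log_nonneg h2) (by norm_num)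
    refine (measure_exists_deviation_le hR.measurable_arm (hR.measurable_projNoise z)
      (hR.setLIntegral_exp_projNoise_le hz1) (Finset.mem_filter.1 hp).2.ne hs0).trans (le_of_eq ?_)
    rw [hs, mul_div_cancel₀ _ two_ne_zero, Real.exp_neg, Real.exp_log (by linarith), inv_div]
  have hbadle : P goodᶜ ≤ ENNReal.ofReal δ := by
    refine (measure_mono hsub).trans ((measure_biUnion_finset_le _ _).trans
      ((Finset.sum_le_sum hpair).trans ?_))
    rw [Finset.sum_const, nsmul_eq_mul, ← ENNReal.ofReal_natCast, ← ENNReal.ofReal_mul (by positivity),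
      hcard]
    refine ENNReal.ofReal_le_ofReal ?_
    rcases eq_or_ne (numPairs K) 0 with h | h
    · rw [h, zero_mul]
      exact hδ0.le
    · exact (mul_div_cancel₀ _ h).le
  have hreal : P.real goodᶜ ≤ δ := ENNReal.toReal_le_of_le_ofReal hδ0.le hbadle
  have huniv : 1 ≤ P.real good + P.real goodᶜ := by
    rw [← probReal_univ (μ := P), ← Set.union_compl_self good]
    exact measureReal_union_le _ _
  linarith
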